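/- Let $E_2(z)=1-24\sum_{n\ge1}\sigma_1(n)q^n$, $q=e^{2\pi i z}$. For an integer $k\ge 1$, a quasimodular form of weight $2k$ for $\mathrm{SL}_2(\mathbb Z)$ is a function on the upper half plane of the form $f=\sum_{j=0}^{k}E_2^{\,j}f_j$, where $f_j$ is a modular form of weight $2k-2j$ for $\mathrm{SL}_2(\mathbb Z)$. Let $\widetilde M_{2k}$ be the complex vector space of these forms, write $f=\sum_{n\ge0}a_f(n)q^n$ for the Fourier expansion of $f\in\widetilde M_{2k}$, and let $\widetilde M_{2k}^{\mathbb Z}$ be the lattice of all $f\in\widetilde M_{2k}$ with $a_f(n)\in\mathbb Z$ for every $n\ge0$. **Proposition 3.3.** Let $k\ge 10$ be an integer. Then $\widetilde M_{2k}$ has a $\mathbb Z$-basis, i.e. a finite $\mathbb C$-basis of $\widetilde M_{2k}$ that is also a basis of the $\mathbb Z$-module $\widetilde M_{2k}^{\mathbb Z}$, such that every element $f$ of the basis satisfies, for all integers $n\ge1$, $$|a_f(n)|\le\left(\frac{k+6}{6}\right)^{k^2/3}\cdot 109\cdot 2^{2k-1}\,n^{2k-1}\,(1+\log n)^k .$$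 -/

import Mathlib

open UpperHalfPlane ModularForm MatrixGroups EisensteinSeries

noncomputable section

/-- The space of quasimodular forms of (pure) weight `2k` for `SL₂(ℤ)`: the functions
`∑_{j=0}^{k} E₂^j f_j` on the upper half plane, where `f_j` is a modular form of weight `2k - 2j`
and `E₂ = 1 - 24 ∑ σ₁(n) qⁿ`. -/
def quasimodularForms (k : ℕ) : Submodule ℂ (ℍ → ℂ) where
  carrier := {f | ∃ g : (j : ℕ) → ModularForm 𝒮ℒ (2 * (k : ℤ) - 2 * (j : ℤ)),
    f = ∑ j ∈ Finset.range (k + 1), E2 ^ j * ⇑(g j)}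
  add_mem' := by
    rintro _ _ ⟨g, rfl⟩ ⟨g', rfl⟩
    refine ⟨fun j => g j + g' j, ?_⟩
    rw [← Finset.sum_add_distrib]
    refine Finset.sum_congr rfl fun j _ => ?_
    ext z
    simp [mul_add]
  zero_mem' := by
    refine ⟨fun j => 0, ?_⟩
    ext z
    simp
  smul_mem' := by
    rintro c _ ⟨g, rfl⟩
    refine ⟨fun j => c • g j, ?_⟩
    rw [Finset.smul_sum]
    refine Finset.sum_congr rfl fun j _ => ?_
    ext z
    simp [mul_left_comm]

/-- The `n`-th Fourier coefficient `a_f(n)` in `f(z) = ∑_{n ≥ 0} a_f(n) qⁿ`, `q = e^{2πiz}`. -/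
def qCoeff (f : ℍ → ℂ) (n : ℕ) : ℂ := (qExpansion 1 f).coeff n

lemma E2_comp_ofComplex_periodic : Function.Periodic (E2 ∘ ofComplex) ((1 : ℝ) : ℂ) := by
  intro w
  by_cases! hw : 0 < w.im
  · have h1 : 0 < (w + ((1 : ℝ) : ℂ)).im := by simpa using hw
    simp only [Function.comp_apply, ofComplex_apply_of_im_pos h1, ofComplex_apply_of_im_pos hw]
    refine HasSum.unique (hasSum_qExpansion_E2 (z := ⟨w + ((1 : ℝ) : ℂ), h1⟩)) ?_
    convert! hasSum_qExpansion_E2 (z := ⟨w, hw⟩) using 4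
    simp [mul_add, Complex.exp_add, Complex.exp_two_pi_mul_I]
  · have h1 : (w + ((1 : ℝ) : ℂ)).im ≤ 0 := by simpa using hw
    rw [Function.comp_apply, Function.comp_apply, ofComplex_apply_of_im_nonpos h1,
      ofComplex_apply_of_im_nonpos hw]

lemma analyticAt_cuspFunction_E2 : AnalyticAt ℂ (cuspFunction 1 E2) 0 :=
  analyticAt_cuspFunction_zero one_pos E2_comp_ofComplex_periodic E2_mdifferentiable
    isBoundedAtImInfty_E2

/-- Every quasimodular form is given near `q = 0` by a convergent power series in `q`. -/
lemma analyticAt_cuspFunction_of_mem_quasimodularForms {k : ℕ} {f : ℍ → ℂ}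
    (hf : f ∈ quasimodularForms k) : AnalyticAt ℂ (cuspFunction 1 f) 0 := by
  have hz : AnalyticAt ℂ (cuspFunction 1 (0 : ℍ → ℂ)) 0 := by
    have := ModularFormClass.analyticAt_cuspFunction_zero (0 : ModularForm 𝒮ℒ 0) one_pos
      one_mem_strictPeriods_SL
    simpa using this
  have ho : AnalyticAt ℂ (cuspFunction 1 (1 : ℍ → ℂ)) 0 := by
    have := ModularFormClass.analyticAt_cuspFunction_zero (1 : ModularForm 𝒮ℒ 0) one_pos
      one_mem_strictPeriods_SL
    simpa using this
  have hmul : ∀ u v : ℍ → ℂ, AnalyticAt ℂ (cuspFunction 1 u) 0 →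
      AnalyticAt ℂ (cuspFunction 1 v) 0 → AnalyticAt ℂ (cuspFunction 1 (u * v)) 0 := by
    intro u v hu hv
    rw [cuspFunction_mul hu.continuousAt hv.continuousAt]
    exact hu.mul hv
  have hpow : ∀ j : ℕ, AnalyticAt ℂ (cuspFunction 1 (E2 ^ j)) 0 := by
    intro j
    induction j with
    | zero => simpa using ho
    | succ j ih =>
      rw [pow_succ]
      exact hmul _ _ ih analyticAt_cuspFunction_E2
  obtain ⟨g, rfl⟩ := hf
  refine Finset.sum_induction _ (fun u : ℍ → ℂ => AnalyticAt ℂ (cuspFunction 1 u) 0) ?_ hz ?_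
  · intro u v hu hv
    rw [cuspFunction_add hu.continuousAt hv.continuousAt]
    exact hu.add hv
  · intro j _
    exact hmul _ _ (hpow j) (ModularFormClass.analyticAt_cuspFunction_zero (g j) one_pos
      one_mem_strictPeriods_SL)

/-- The lattice of quasimodular forms of weight `2k` for `SL₂(ℤ)` all of whose Fourier
coefficients are integers. -/
def integralQuasimodularForms (k : ℕ) : Submodule ℤ (ℍ → ℂ) where
  carrier := {f | f ∈ quasimodularForms k ∧ ∀ n : ℕ, ∃ m : ℤ, qCoeff f n = m}
  add_mem' := by
    rintro f g ⟨hf, hf'⟩ ⟨hg, hg'⟩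
    refine ⟨add_mem hf hg, fun n => ?_⟩
    obtain ⟨a, ha⟩ := hf' n
    obtain ⟨b, hb⟩ := hg' n
    refine ⟨a + b, ?_⟩
    rw [qCoeff] at *
    rw [qExpansion_add (analyticAt_cuspFunction_of_mem_quasimodularForms hf)
      (analyticAt_cuspFunction_of_mem_quasimodularForms hg), map_add, ha, hb]
    push_cast
    rfl
  zero_mem' := ⟨zero_mem _, fun n => ⟨0, by simp [qCoeff, qExpansion_zero]⟩⟩
  smul_mem' := by
    rintro c f ⟨hf, hf'⟩
    have hc : c • f = (c : ℂ) • f := by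
      ext z
      simp
    rw [hc]
    refine ⟨Submodule.smul_mem _ _ hf, fun n => ?_⟩
    obtain ⟨a, ha⟩ := hf' n
    refine ⟨c * a, ?_⟩
    rw [qCoeff] at *
    rw [qExpansion_smul (analyticAt_cuspFunction_of_mem_quasimodularForms hf),
      PowerSeries.coeff_smul, ha]
    push_cast
    rfl

end

/-!
The monomials `E₂^a E₄^b E₆^c` of weight `2k` have integral Fourier coefficients and span the space
of quasimodular forms: `modularForm_mem_eisensteinSpan` shows that `E₄` and `E₆` generate all
modular forms of level one. A subfamily `v` of the monomials is therefore a complex basis, with at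
most `(k + 1)²` elements. Neither the algebraic independence of `E₂`, `E₄`, `E₆` nor the exact
dimension is needed.

The `ℤ`-span of `v` is in general smaller than the lattice of integral forms, but of finite index:
the coordinates of a form with respect to `v` are rational linear combinations of finitely many of
its Fourier coefficients (`exists_common_denominator`). A lattice between `ℤ^d` and `D⁻¹ ℤ^d`
has a triangular basis, and subtracting standard basis vectors brings all its entries into `[-1, 1]`
(`exists_basis_abs_le`, `exists_basis_coord_le_one`). So the lattice of integral forms has a basis
each of whose elements is a combination of the `v j` with coefficients of absolute value at most `1`.

It remains to bound the coefficients of a monomial. The partial sums `∑_{i ≤ n} |a(i)|` are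
submultiplicative in the power series, and `σ_s(n) ≤ n^s (1 + log n)`, which gives the bound
`25^k n^{2k-1} (1 + log n)^k` (`hasWeightGrowth_eisensteinMonomial`). Finally `(k + 1)² 25^k` is
below the constant of the theorem for `k ≥ 10` (`succ_sq_mul_pow_le`).
-/

open scoped Manifold ArithmeticFunction.sigma

/-! ### Lattices squeezed between `ℤ^d` and a multiple of it -/

/-- In a sublattice of `ℤ^d` containing `D ℤ^d`, some vector vanishes beyond coordinate `i`, has all
entries of size at most `D`, and its `i`-th entry divides the `i`-th entry of every other lattice
vector vanishing beyond coordinate `i`. -/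
lemma exists_triangular_vector {d : ℕ} (L : Submodule ℤ (Fin d → ℤ)) {D : ℤ} (hD : 0 < D)
    (hL : ∀ i, Pi.single i D ∈ L) (i : Fin d) :
    ∃ w ∈ L, (∀ j, i < j → w j = 0) ∧ w i ≠ 0 ∧ (∀ j, |w j| ≤ D) ∧
      ∀ x ∈ L, (∀ j, i < j → x j = 0) → w i ∣ x i := by
  -- The `i`-th entries of the lattice vectors vanishing beyond `i` form a principal ideal.
  let I : Ideal ℤ :=
    { carrier := {c | ∃ x ∈ L, (∀ j, i < j → x j = 0) ∧ x i = c}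
      add_mem' := by
        rintro _ _ ⟨x, hx, hx', rfl⟩ ⟨y, hy, hy', rfl⟩
        exact ⟨x + y, add_mem hx hy, fun j hj => by simp [hx' j hj, hy' j hj], rfl⟩
      zero_mem' := ⟨0, zero_mem _, fun _ _ => rfl, rfl⟩
      smul_mem' := by
        rintro c _ ⟨x, hx, hx', rfl⟩
        exact ⟨c • x, L.smul_mem c hx, fun j hj => by simp [hx' j hj], rfl⟩ }
  obtain ⟨c, hc⟩ := (IsPrincipalIdealRing.principal I).principal
  have hc' : ∀ a, a ∈ I ↔ c ∣ a := fun a => by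
    rw [hc]
    exact Ideal.mem_span_singleton
  obtain ⟨x, hx, hx0, hxi⟩ : c ∈ I := (hc' c).2 dvd_rfl
  have hcD : c ∣ D := (hc' D).1
    ⟨Pi.single i D, hL i, fun j hj => Pi.single_eq_of_ne hj.ne' _, Pi.single_eq_same _ _⟩
  have hc0 : c ≠ 0 := by
    rintro rfl
    exact hD.ne' (zero_dvd_iff.1 hcD)
  -- Reducing the entries before `i` modulo `D` stays inside the lattice.
  let y : Fin d → ℤ := fun j => if j < i then x j / D else 0
  have hz : (fun j => x j - y j * D) ∈ L := by
    have hy : ∑ j, y j • (Pi.single j D : Fin d → ℤ) = fun j => y j * D := by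
      ext l
      simp [Finset.sum_apply, Pi.single_apply]
    have := sub_mem hx (sum_mem fun j (_ : j ∈ Finset.univ) => L.smul_mem (y j) (hL j))
    rwa [hy] at this
  refine ⟨_, hz, ?_, ?_, ?_, ?_⟩
  · intro j hj
    simp [y, hx0 j hj]
  · simpa [y, hxi] using hc0
  · intro j
    rcases lt_trichotomy j i with hj | rfl | hj
    · have : x j - y j * D = x j % D := by
        simp only [y, hj, if_true, Int.emod_def]
        ring
      rw [this, abs_of_nonneg (Int.emod_nonneg _ hD.ne')]
      exact (Int.emod_lt_of_pos _ hD).le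
    · simpa [y, hxi] using Int.le_of_dvd hD ((abs_dvd _ _).2 hcD)
    · simpa [y, hx0 j hj, hj.not_gt] using hD.le
  · intro z hz hz0
    have : c ∣ z i := (hc' _).1 ⟨z, hz, hz0, rfl⟩
    simpa [y, hxi] using this

/-- A sublattice of `ℤ^d` containing `D ℤ^d` has a basis whose vectors have entries of size at
most `D`. -/
theorem exists_basis_abs_le {d : ℕ} (L : Submodule ℤ (Fin d → ℤ)) {D : ℤ} (hD : 0 < D)
    (hL : ∀ i, Pi.single i D ∈ L) :
    ∃ b : Module.Basis (Fin d) ℤ L, ∀ i j, |(b i : Fin d → ℤ) j| ≤ D := by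
  choose w hwL hw0 hwi hwD hdvd using exists_triangular_vector L hD hL
  have hli : LinearIndependent ℤ w := by
    have hdet : (Matrix.of w).det ≠ 0 := by
      rw [Matrix.det_of_isLowerTriangular (Matrix.of w) fun i j hij => hw0 i j hij]
      exact Finset.prod_ne_zero_iff.2 fun i _ => hwi i
    exact Matrix.linearIndependent_rows_of_det_ne_zero hdet
  -- The entries are cleared from the last one downwards.
  have hspan : ∀ n : ℕ, ∀ x ∈ L, (∀ j : Fin d, n ≤ j → x j = 0) →
      x ∈ Submodule.span ℤ (Set.range w) := by
    intro n
    induction n with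
    | zero =>
      intro x _ hx
      rw [show x = 0 from funext fun j => hx j (Nat.zero_le _)]
      exact zero_mem _
    | succ n ih =>
      intro x hxL hx
      by_cases hn : n < d
      · obtain ⟨m, hm⟩ := hdvd ⟨n, hn⟩ x hxL fun j hj => hx j hj
        have hmem : w ⟨n, hn⟩ ∈ Submodule.span ℤ (Set.range w) :=
          Submodule.subset_span ⟨_, rfl⟩
        have := ih (x - m • w ⟨n, hn⟩) (sub_mem hxL (L.smul_mem _ (hwL _))) fun j hj => by
          rcases hj.eq_or_lt with hj | hj
          · obtain rfl : j = ⟨n, hn⟩ := Fin.ext hj.symm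
            simp [hm, mul_comm]
          · simp [hx j hj, hw0 ⟨n, hn⟩ j hj]
        simpa using add_mem this (Submodule.smul_mem _ m hmem)
      · exact ih x hxL fun j hj => absurd j.2 (by omega)
  have hspan' : Submodule.span ℤ (Set.range w) = L := by
    refine le_antisymm (Submodule.span_le.2 ?_) fun x hx =>
      hspan d x hx fun j hj => absurd j.2 (by omega)
    rintro _ ⟨i, rfl⟩
    exact hwL i
  refine ⟨(Module.Basis.span hli).map (LinearEquiv.ofEq _ _ hspan'), fun i j => ?_⟩
  have : (((Module.Basis.span hli).map (LinearEquiv.ofEq _ _ hspan') i : L) : Fin d → ℤ) = w i := by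
    simp [Module.Basis.span_apply]
  rw [this]
  exact hwD i j

/-- A lattice that contains the `ℤ`-span of linearly independent vectors `v j` with bounded
denominators has a basis whose coordinates with respect to `v` have absolute value at most `1`. -/
theorem exists_basis_coord_le_one {V : Type*} [AddCommGroup V] [Module ℂ V] {d : ℕ}
    {v : Fin d → V} (hv : LinearIndependent ℂ v) (L : Submodule ℤ V) (hvL : ∀ i, v i ∈ L)
    {D : ℤ} (hD : 0 < D) (hL : ∀ f ∈ L, ∃ x : Fin d → ℤ, D • f = ∑ j, x j • v j) :
    ∃ b : Module.Basis (Fin d) ℤ L,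
      ∀ i, ∃ t : Fin d → ℂ, (∀ j, ‖t j‖ ≤ 1) ∧ (b i : V) = ∑ j, t j • v j := by
  have hD0 : (D : ℂ) ≠ 0 := by exact_mod_cast hD.ne'
  let ψ : (Fin d → ℤ) →ₗ[ℤ] V := Fintype.linearCombination ℤ fun j => (D : ℂ)⁻¹ • v j
  have hψ : ∀ x, ψ x = ∑ j, ((x j : ℂ) / D) • v j := fun x => by
    simp only [ψ, Fintype.linearCombination_apply, div_eq_mul_inv, mul_smul, Int.cast_smul_eq_zsmul]
  have hinj : Function.Injective ψ := by
    rw [← LinearMap.ker_eq_bot, LinearMap.ker_eq_bot']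
    intro x hx
    rw [hψ] at hx
    ext j
    simpa [hD0] using Fintype.linearIndependent_iff.1 hv _ hx j
  have hrange : L ≤ LinearMap.range ψ := by
    intro f hf
    obtain ⟨x, hx⟩ := hL f hf
    refine ⟨x, ?_⟩
    rw [hψ, ← smul_right_injective V hD0 |>.eq_iff]
    simp only [Finset.smul_sum, smul_smul, mul_div_cancel₀ _ hD0, Int.cast_smul_eq_zsmul]
    exact hx.symm
  obtain ⟨b, hb⟩ := exists_basis_abs_le (L.comap ψ) hD fun i => by
    have : ψ (Pi.single i D) = v i := by
      rw [hψ, Finset.sum_eq_single i] <;> simp +contextual [hD0]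
    simpa [this] using hvL i
  let e : L.comap ψ ≃ₗ[ℤ] L := (Submodule.equivMapOfInjective ψ hinj _).trans
    (LinearEquiv.ofEq _ _ (Submodule.map_comap_eq_of_le hrange))
  refine ⟨b.map e, fun i => ⟨fun j => (((b i : Fin d → ℤ) j : ℤ) : ℂ) / D, fun j => ?_, ?_⟩⟩
  · rw [norm_div, Complex.norm_intCast, Complex.norm_intCast, abs_of_pos (Int.cast_pos.2 hD)]
    refine div_le_one_of_le₀ ?_ (Int.cast_nonneg hD.le)
    exact_mod_cast hb i j
  · rw [← hψ]
    rfl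

/-- If linearly independent sequences `u j` consist of integers, then the coefficients of all
integral sequences in their complex span have a common denominator. -/
theorem exists_common_denominator {d : ℕ} {u : Fin d → ℕ → ℤ}
    (hu : LinearIndependent ℂ fun j n => (u j n : ℂ)) :
    ∃ D : ℤ, 0 < D ∧ ∀ x : Fin d → ℂ, (∀ n, ∃ m : ℤ, ∑ j, x j * u j n = m) →
      ∀ j, ∃ m : ℤ, D * x j = m := by
  -- The rational functionals `x ↦ ∑ j, u j n * x j`, for varying `n`, span the dual of `ℚ^d`.
  have htop : Submodule.span ℚ (Set.range fun n j => (u j n : ℚ)) = ⊤ := by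
    by_contra h
    obtain ⟨f, hf0, hf⟩ := Submodule.exists_le_ker_of_lt_top _ (lt_top_iff_ne_top.2 h)
    have hfx : ∀ y, f y = ∑ j, y j * f (Pi.single j 1) := fun y => by
      conv_lhs => rw [← Finset.univ_sum_single y, map_sum]
      refine Finset.sum_congr rfl fun j _ => ?_
      rw [← smul_eq_mul, ← map_smul, ← Pi.single_smul, smul_eq_mul, mul_one]
    refine hf0 (LinearMap.pi_ext' fun j => LinearMap.ext_ring ?_)
    have := Fintype.linearIndependent_iff.1 hu (fun j => (f (Pi.single j 1) : ℂ)) (by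
      ext n
      have h0 : f (fun j => (u j n : ℚ)) = 0 := hf (Submodule.subset_span ⟨n, rfl⟩)
      rw [hfx] at h0
      simp only [Finset.sum_apply, Pi.smul_apply, smul_eq_mul, Pi.zero_apply]
      rw [← Rat.cast_zero, ← h0]
      push_cast
      exact Finset.sum_congr rfl fun j _ => mul_comm _ _) j
    simpa using this
  have key : ∀ t : Fin d → ℚ, t ∈ Submodule.span ℚ (Set.range fun n j => (u j n : ℚ)) →
      ∃ D : ℤ, 0 < D ∧ ∀ x : Fin d → ℂ, (∀ n, ∃ m : ℤ, ∑ j, x j * u j n = m) →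
        ∃ m : ℤ, D * ∑ j, t j * x j = m := by
    intro t ht
    induction ht using Submodule.span_induction with
    | mem t ht =>
      obtain ⟨n, rfl⟩ := ht
      refine ⟨1, one_pos, fun x hx => ?_⟩
      obtain ⟨m, hm⟩ := hx n
      refine ⟨m, ?_⟩
      rw [← hm, Int.cast_one, one_mul]
      exact Finset.sum_congr rfl fun j _ => by push_cast; ring
    | zero => exact ⟨1, one_pos, fun x _ => ⟨0, by simp⟩⟩
    | add s t _ _ hs ht =>
      obtain ⟨D, hD, h⟩ := hs
      obtain ⟨D', hD', h'⟩ := ht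
      refine ⟨D * D', mul_pos hD hD', fun x hx => ?_⟩
      obtain ⟨m, hm⟩ := h x hx
      obtain ⟨m', hm'⟩ := h' x hx
      refine ⟨D' * m + D * m', ?_⟩
      simp only [Pi.add_apply, Rat.cast_add, add_mul, Finset.sum_add_distrib]
      push_cast
      rw [← hm, ← hm']
      ring
    | smul q t _ ht =>
      obtain ⟨D, hD, h⟩ := ht
      refine ⟨q.den * D, mul_pos (mod_cast q.den_pos) hD, fun x hx => ?_⟩
      obtain ⟨m, hm⟩ := h x hx
      refine ⟨q.num * m, ?_⟩
      have hq : (q.den : ℂ) * (q : ℂ) = q.num := by exact_mod_cast Rat.den_mul_eq_num q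
      simp only [Pi.smul_apply, smul_eq_mul, Rat.cast_mul, mul_assoc, ← Finset.mul_sum]
      push_cast
      rw [← hm, ← hq]
      ring
  choose D hD h using fun j => key (Pi.single j 1) (htop ▸ Submodule.mem_top)
  refine ⟨∏ j, D j, Finset.prod_pos fun j _ => hD j, fun x hx j => ?_⟩
  obtain ⟨m, hm⟩ := h j x hx
  refine ⟨(∏ i ∈ Finset.univ.erase j, D i) * m, ?_⟩
  have hsum : ∑ i, ((Pi.single j (1 : ℚ) : Fin d → ℚ) i : ℂ) * x i = x j := by
    rw [Finset.sum_eq_single j] <;> simp +contextual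
  rw [← Finset.mul_prod_erase _ _ (Finset.mem_univ j)]
  push_cast
  rw [← hm, hsum]
  ring

/-! ### Quasimodular forms are spanned by monomials in `E₂`, `E₄`, `E₆` -/

/-- The functions on the upper half plane that are `1`-periodic, holomorphic, and bounded at `i∞`,
i.e. the holomorphic functions of `q = e^{2πiz}` on the unit disc. -/
noncomputable def cuspHolomorphic : Subalgebra ℂ (ℍ → ℂ) where
  carrier := {f | Function.Periodic (f ∘ ofComplex) ((1 : ℝ) : ℂ) ∧ MDiff f ∧
    IsBoundedAtImInfty f}
  mul_mem' := by
    rintro f g ⟨h1, h2, h3⟩ ⟨h1', h2', h3'⟩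
    exact ⟨h1.mul h1', h2.mul h2', h3.mul h3'⟩
  add_mem' := by
    rintro f g ⟨h1, h2, h3⟩ ⟨h1', h2', h3'⟩
    exact ⟨h1.add h1', h2.add h2', h3.add h3'⟩
  algebraMap_mem' c :=
    ⟨fun _ => rfl, mdifferentiable_const, Filter.const_boundedAtFilter _ c⟩

lemma modularForm_mem_cuspHolomorphic {w : ℤ} (f : ModularForm 𝒮ℒ w) :
    (f : ℍ → ℂ) ∈ cuspHolomorphic :=
  have : Fact (IsCusp OnePoint.infty 𝒮ℒ) :=
    ⟨Subgroup.isCusp_of_mem_strictPeriods one_pos one_mem_strictPeriods_SL⟩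
  ⟨SlashInvariantFormClass.periodic_comp_ofComplex f one_mem_strictPeriods_SL,
    ModularFormClass.holo f, ModularFormClass.bdd_at_infty f⟩

lemma E2_mem_cuspHolomorphic : E2 ∈ cuspHolomorphic :=
  ⟨E2_comp_ofComplex_periodic, E2_mdifferentiable, isBoundedAtImInfty_E2⟩

lemma analyticAt_cuspFunction_of_mem_cuspHolomorphic {f : ℍ → ℂ} (hf : f ∈ cuspHolomorphic) :
    AnalyticAt ℂ (cuspFunction 1 f) 0 :=
  analyticAt_cuspFunction_zero one_pos hf.1 hf.2.1 hf.2.2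

/-- The `q`-expansion as a homomorphism of algebras. -/
noncomputable def cuspExpansion : cuspHolomorphic →ₐ[ℂ] PowerSeries ℂ :=
  AlgHom.ofLinearMap
    { toFun := fun f => qExpansion 1 (f : ℍ → ℂ)
      map_add' := fun f g => qExpansion_add (analyticAt_cuspFunction_of_mem_cuspHolomorphic f.2)
        (analyticAt_cuspFunction_of_mem_cuspHolomorphic g.2)
      map_smul' := fun c f =>
        qExpansion_smul (analyticAt_cuspFunction_of_mem_cuspHolomorphic f.2) c }
    (qExpansion_one 1)
    fun f g => qExpansion_mul (analyticAt_cuspFunction_of_mem_cuspHolomorphic f.2)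
      (analyticAt_cuspFunction_of_mem_cuspHolomorphic g.2)

lemma cuspExpansion_apply (f : cuspHolomorphic) : cuspExpansion f = qExpansion 1 (f : ℍ → ℂ) := rfl

lemma cuspExpansion_injective : Function.Injective cuspExpansion := by
  refine (injective_iff_map_eq_zero _).2 fun f hf => Subtype.ext ?_
  exact (qExpansion_eq_zero_iff one_pos f.2.1 f.2.2.1 f.2.2.2).1 hf

/-- The span of the monomials `E₄^b E₆^c` of weight `2m`. -/
noncomputable def eisensteinSpan (m : ℕ) : Submodule ℂ (ℍ → ℂ) :=
  Submodule.span ℂ {f | ∃ b c : ℕ, 2 * b + 3 * c = m ∧ f = ⇑E₄ ^ b * ⇑E₆ ^ c}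

lemma discriminant_mul_mem_eisensteinSpan {m : ℕ} {f : ℍ → ℂ} (hf : f ∈ eisensteinSpan m) :
    discriminant * f ∈ eisensteinSpan (m + 6) := by
  have hD : discriminant = (1 / 1728 : ℂ) • (⇑E₄ ^ 3 - ⇑E₆ ^ 2) := by
    ext z
    simp only [discriminant_eq_E₄_cube_sub_E₆_sq, Pi.smul_apply, Pi.sub_apply, Pi.pow_apply,
      smul_eq_mul]
    ring
  induction hf using Submodule.span_induction with
  | mem f hf =>
    obtain ⟨b, c, rfl, rfl⟩ := hf
    have h : discriminant * (⇑E₄ ^ b * ⇑E₆ ^ c) =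
        (1 / 1728 : ℂ) • (⇑E₄ ^ (b + 3) * ⇑E₆ ^ c - ⇑E₄ ^ b * ⇑E₆ ^ (c + 2)) := by
      rw [hD, smul_mul_assoc]
      congr 1
      ring
    rw [h]
    exact Submodule.smul_mem _ _ (sub_mem (Submodule.subset_span ⟨_, _, by ring, rfl⟩)
      (Submodule.subset_span ⟨_, _, by ring, rfl⟩))
  | zero => simp
  | add f g _ _ hf hg =>
    rw [mul_add]
    exact add_mem hf hg
  | smul c f _ hf =>
    rw [mul_smul_comm]
    exact Submodule.smul_mem _ _ hf

/-- Modular forms of level one are polynomials in `E₄` and `E₆`: subtracting a multiple of a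
monomial `E₄^b E₆^c` leaves a cusp form, which is divisible by the discriminant. -/
theorem modularForm_mem_eisensteinSpan (m : ℕ) {w : ℤ} (hw : w = 2 * m) (f : ModularForm 𝒮ℒ w) :
    (f : ℍ → ℂ) ∈ eisensteinSpan m := by
  induction m using Nat.strong_induction_on generalizing w with | _ m ih =>
  rcases Nat.lt_or_ge 1 m with hm | hm
  · obtain ⟨b, c, hbc⟩ : ∃ b c, 2 * b + 3 * c = m := by
      obtain ⟨t, rfl | rfl⟩ := Nat.even_or_odd' m
      · exact ⟨t, 0, by omega⟩
      · exact ⟨t - 1, 1, by omega⟩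
    let g : ModularForm 𝒮ℒ w :=
      ModularForm.mcast (by push_cast [hw, ← hbc]; ring) ((E₄.pow b).mul (E₆.pow c))
    have hg : (g : ℍ → ℂ) = ⇑E₄ ^ b * ⇑E₆ ^ c := by
      simp [g]
    have hg0 : (qExpansion 1 g).coeff 0 = 1 := by
      have : qExpansion 1 g = qExpansion 1 E₄ ^ b * qExpansion 1 E₆ ^ c := by
        rw [ModularForm.qExpansion_mcast, ModularForm.qExpansion_mul one_pos
          one_mem_strictPeriods_SL, ModularForm.qExpansion_pow one_pos one_mem_strictPeriods_SL,
          ModularForm.qExpansion_pow one_pos one_mem_strictPeriods_SL]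
      have h4 := E_qExpansion_coeff_zero (k := 4) (by norm_num) ⟨2, rfl⟩
      have h6 := E_qExpansion_coeff_zero (k := 6) (by norm_num) ⟨3, rfl⟩
      rw [PowerSeries.coeff_zero_eq_constantCoeff_apply] at h4 h6 ⊢
      simp [this, h4, h6]
    let a := (qExpansion 1 f).coeff 0
    have h0 : (qExpansion 1 (f - a • g : ModularForm 𝒮ℒ w)).coeff 0 = 0 := by
      rw [FunLike.coe_sub, ModularForm.qExpansion_sub one_pos one_mem_strictPeriods_SL,
        FunLike.coe_smul, ModularForm.qExpansion_smul one_pos one_mem_strictPeriods_SL, map_sub,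
        PowerSeries.coeff_smul, hg0]
      simp [a]
    let h := CuspForm.discriminantEquiv (toCuspForm (f - a • g) h0)
    have hh : (f : ℍ → ℂ) = discriminant * h + a • (g : ℍ → ℂ) := by
      rw [discriminant_mul_discriminantEquiv]
      ext z
      simp
    rw [hh]
    refine add_mem ?_ (Submodule.smul_mem _ _ (Submodule.subset_span ⟨b, c, hbc, hg⟩))
    by_cases h6 : 6 ≤ m
    · have := discriminant_mul_mem_eisensteinSpan
        (ih (m - 6) (by omega) (w := w - 12) (by push_cast [hw, h6]; ring) h)
      rwa [Nat.sub_add_cancel h6] at this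
    · rw [ModularFormClass.levelOne_neg_weight_eq_zero (by omega) h, mul_zero]
      exact zero_mem _
  · obtain rfl | rfl : m = 0 ∨ m = 1 := by omega
    · obtain rfl : w = 0 := by simpa using hw
      obtain ⟨c, hc⟩ := ModularFormClass.levelOne_weight_zero_const f
      rw [hc, show Function.const ℍ c = c • (⇑E₄ ^ 0 * ⇑E₆ ^ 0) by ext; simp]
      exact Submodule.smul_mem _ _ (Submodule.subset_span ⟨0, 0, rfl, rfl⟩)
    · obtain rfl : w = 2 := by simpa using hw
      rw [rank_zero_iff_forall_zero.mp levelOne_weight_two_rank_zero f]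
      exact zero_mem _

/-- The monomials `E₂^a E₄^b E₆^c` of weight `2k`, indexed by the pairs `(b, c)` with
`2b + 3c ≤ k`. -/
noncomputable def eisensteinMonomial (k : ℕ)
    (p : {p : Fin (k + 1) × Fin (k + 1) // 2 * (p.1 : ℕ) + 3 * (p.2 : ℕ) ≤ k}) : ℍ → ℂ :=
  E2 ^ (k - (2 * (p.1.1 : ℕ) + 3 * (p.1.2 : ℕ))) * (⇑E₄ ^ (p.1.1 : ℕ) * ⇑E₆ ^ (p.1.2 : ℕ))

lemma span_eisensteinMonomial (k : ℕ) :
    Submodule.span ℂ (Set.range (eisensteinMonomial k)) = quasimodularForms k := by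
  refine le_antisymm (Submodule.span_le.2 ?_) ?_
  · rintro _ ⟨⟨⟨b, c⟩, h⟩, rfl⟩
    obtain ⟨j, hj⟩ := Nat.exists_eq_add_of_le h
    dsimp only at hj h
    refine ⟨fun i => if hi : i = j then
      ModularForm.mcast (by subst hi; omega) ((E₄.pow b).mul (E₆.pow c)) else 0, ?_⟩
    rw [Finset.sum_eq_single j]
    · simp [eisensteinMonomial, show k - (2 * (b : ℕ) + 3 * (c : ℕ)) = j by omega]
    · intro i _ hi
      simp [hi]
    · intro hj'
      exact absurd (Finset.mem_range.2 (by omega)) hj'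
  · rintro _ ⟨g, rfl⟩
    refine sum_mem fun j hj => ?_
    have hjk : j ≤ k := Nat.lt_succ_iff.1 (Finset.mem_range.1 hj)
    have hg := modularForm_mem_eisensteinSpan (k - j) (by push_cast [hjk]; ring) (g j)
    generalize (g j : ℍ → ℂ) = f at hg
    induction hg using Submodule.span_induction with
    | mem f hf =>
      obtain ⟨b, c, hbc, rfl⟩ := hf
      refine Submodule.subset_span ⟨⟨(⟨b, by omega⟩, ⟨c, by omega⟩), by dsimp only; omega⟩, ?_⟩
      simp [eisensteinMonomial, show k - (2 * b + 3 * c) = j by omega]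
    | zero => simp
    | add f g _ _ hf hg =>
      rw [mul_add]
      exact add_mem hf hg
    | smul c f _ hf =>
      rw [mul_smul_comm]
      exact Submodule.smul_mem _ _ hf

lemma quasimodularForms_le_cuspHolomorphic {k : ℕ} {f : ℍ → ℂ} (hf : f ∈ quasimodularForms k) :
    f ∈ cuspHolomorphic := by
  obtain ⟨g, rfl⟩ := hf
  exact sum_mem fun j _ =>
    mul_mem (pow_mem E2_mem_cuspHolomorphic j) (modularForm_mem_cuspHolomorphic (g j))

/-! ### Growth of the coefficients of Eisenstein monomials -/

/-- The partial sums of the absolute values of the coefficients are submultiplicative. -/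
lemma sum_norm_coeff_mul_le (p q : PowerSeries ℂ) (n : ℕ) :
    ∑ i ∈ Finset.range (n + 1), ‖(p * q).coeff i‖ ≤
      (∑ i ∈ Finset.range (n + 1), ‖p.coeff i‖) * ∑ i ∈ Finset.range (n + 1), ‖q.coeff i‖ := by
  calc ∑ i ∈ Finset.range (n + 1), ‖(p * q).coeff i‖
      ≤ ∑ m ∈ Finset.range (n + 1), ∑ i ∈ Finset.range (m + 1),
          ‖p.coeff i‖ * ‖q.coeff (m - i)‖ := by
        refine Finset.sum_le_sum fun m _ => ?_
        rw [PowerSeries.coeff_mul, Finset.Nat.sum_antidiagonal_eq_sum_range_succ_mk]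
        exact (norm_sum_le _ _).trans_eq (Finset.sum_congr rfl fun i _ => norm_mul _ _)
    _ = ∑ i ∈ Finset.range (n + 1), ∑ j ∈ Finset.range (n + 1 - i),
          ‖p.coeff i‖ * ‖q.coeff j‖ :=
        Finset.sum_range_diag_flip _ fun i j => ‖p.coeff i‖ * ‖q.coeff j‖
    _ ≤ _ := by
        rw [Finset.sum_mul_sum]
        refine Finset.sum_le_sum fun i _ => Finset.sum_le_sum_of_subset_of_nonneg ?_
          fun _ _ _ => by positivity
        exact Finset.range_subset_range.2 (Nat.sub_le _ _)

/-- A coefficient of a product is bounded by a partial sum of one factor times a uniform bound for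
the coefficients of the other. -/
lemma norm_coeff_mul_le {p q : PowerSeries ℂ} {n : ℕ} {B : ℝ} (hB : ∀ i ≤ n, ‖q.coeff i‖ ≤ B)
    {i : ℕ} (hi : i ≤ n) :
    ‖(p * q).coeff i‖ ≤ (∑ j ∈ Finset.range (n + 1), ‖p.coeff j‖) * B := by
  have hB0 : 0 ≤ B := (norm_nonneg _).trans (hB 0 (Nat.zero_le _))
  rw [PowerSeries.coeff_mul, Finset.Nat.sum_antidiagonal_eq_sum_range_succ_mk, Finset.sum_mul]
  refine (norm_sum_le _ _).trans ?_
  refine (Finset.sum_le_sum (g := fun j => ‖p.coeff j‖ * B) fun j _ => ?_).trans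
    (Finset.sum_le_sum_of_subset_of_nonneg (Finset.range_subset_range.2 (by omega))
      fun _ _ _ => by positivity)
  rw [norm_mul]
  exact mul_le_mul_of_nonneg_left (hB _ (by omega)) (norm_nonneg _)

/-- Growth of the coefficients expected in weight `2m`: the first `n` of them sum up to
`O(n^{2m} (1 + log n)^m)`, and in positive weight each of them is smaller than that by a
factor `n`. The constant `25^m` makes this condition multiplicative. -/
def HasWeightGrowth (p : PowerSeries ℂ) (m : ℕ) : Prop :=
  ∀ n : ℕ, 1 ≤ n →
    ∑ i ∈ Finset.range (n + 1), ‖p.coeff i‖ ≤ 25 ^ m * (n : ℝ) ^ (2 * m) * (1 + Real.log n) ^ m ∧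
    (1 ≤ m → ∀ i ≤ n,
      ‖p.coeff i‖ ≤ 25 ^ m * (n : ℝ) ^ (2 * m - 1) * (1 + Real.log n) ^ m)

lemma hasWeightGrowth_one : HasWeightGrowth 1 0 := by
  refine fun n _ => ⟨?_, fun h => absurd h (by norm_num)⟩
  rw [Finset.sum_eq_single 0] <;> simp +contextual [PowerSeries.coeff_one]

lemma HasWeightGrowth.mul {p q : PowerSeries ℂ} {m l : ℕ} (hp : HasWeightGrowth p m)
    (hq : HasWeightGrowth q l) : HasWeightGrowth (p * q) (m + l) := by
  -- The factor carrying the pointwise bound has to have positive weight.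
  have key : ∀ {p q : PowerSeries ℂ} {m l : ℕ}, HasWeightGrowth p m → HasWeightGrowth q l →
      1 ≤ l → ∀ n : ℕ, 1 ≤ n → ∀ i ≤ n, ‖(p * q).coeff i‖ ≤
        25 ^ (m + l) * (n : ℝ) ^ (2 * (m + l) - 1) * (1 + Real.log n) ^ (m + l) := by
    intro p q m l hp hq hl n hn i hi
    have hlog : 0 ≤ Real.log n := Real.log_natCast_nonneg n
    refine (norm_coeff_mul_le ((hq n hn).2 hl) hi).trans
      ((mul_le_mul_of_nonneg_right (hp n hn).1 (by positivity)).trans_eq ?_)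
    rw [show 2 * (m + l) - 1 = 2 * m + (2 * l - 1) by omega]
    ring
  refine fun n hn => ⟨?_, fun hml => ?_⟩
  · have hlog : 0 ≤ Real.log n := Real.log_natCast_nonneg n
    refine (sum_norm_coeff_mul_le p q n).trans
      ((mul_le_mul (hp n hn).1 (hq n hn).1 (by positivity) (by positivity)).trans_eq ?_)
    ring
  · rcases Nat.eq_zero_or_pos l with rfl | hl
    · have := key hq hp (by omega) n hn
      rwa [mul_comm q p, add_comm 0 m] at this
    · exact key hp hq hl n hn

lemma HasWeightGrowth.pow {p : PowerSeries ℂ} {m : ℕ} (hp : HasWeightGrowth p m) (a : ℕ) :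
    HasWeightGrowth (p ^ a) (a * m) := by
  induction a with
  | zero => simpa using hasWeightGrowth_one
  | succ a ih =>
    rw [pow_succ, Nat.succ_mul]
    exact ih.mul hp

lemma sigma_le_pow_mul_one_add_log {s n : ℕ} (hs : 1 ≤ s) :
    (σ s n : ℝ) ≤ (n : ℝ) ^ s * (1 + Real.log n) := by
  calc (σ s n : ℝ) = ∑ d ∈ n.divisors, ((n / d : ℕ) : ℝ) ^ s := by
        rw [Nat.sum_div_divisors n fun d => (d : ℝ) ^ s, ArithmeticFunction.sigma_apply]
        push_cast
        rfl
    _ ≤ ∑ d ∈ n.divisors, (n : ℝ) ^ s * (d : ℝ)⁻¹ := by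
        refine Finset.sum_le_sum fun d hd => ?_
        have hd1 : (1 : ℝ) ≤ d := by exact_mod_cast Nat.pos_of_mem_divisors hd
        rw [Nat.cast_div (Nat.dvd_of_mem_divisors hd) (by positivity), div_pow, div_eq_mul_inv]
        gcongr
        exact le_self_pow₀ hd1 (by omega)
    _ ≤ (n : ℝ) ^ s * (harmonic n : ℝ) := by
        rw [← Finset.mul_sum, harmonic_eq_sum_Icc]
        push_cast
        gcongr
        exact fun d hd => Finset.mem_Icc.2 ⟨Nat.pos_of_mem_divisors hd, Nat.divisor_le hd⟩
    _ ≤ _ := by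
        gcongr
        exact harmonic_le_one_add_log n

lemma hasWeightGrowth_of_sigma {p : PowerSeries ℂ} {r : ℕ} {c : ℤ} (hr : 1 ≤ r)
    (hp : ∀ n, p.coeff n = if n = 0 then 1 else (c : ℂ) * σ (2 * r - 1) n)
    (hc : |c| + 1 ≤ 25 ^ r) : HasWeightGrowth p r := by
  have hc' : |(c : ℝ)| + 1 ≤ 25 ^ r := by exact_mod_cast hc
  intro n hn
  have hn1 : (1 : ℝ) ≤ n := by exact_mod_cast hn
  have hlog : 0 ≤ Real.log n := Real.log_natCast_nonneg n
  set L := 1 + Real.log n with hL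
  have hL1 : 1 ≤ L := by linarith
  have hLr : L ≤ L ^ r := le_self_pow₀ hL1 (by omega)
  have hpos : ∀ i ≤ n, i ≠ 0 → ‖p.coeff i‖ ≤ |(c : ℝ)| * ((n : ℝ) ^ (2 * r - 1) * L) := by
    intro i hi hi0
    have hi' : (i : ℝ) ≤ n := by exact_mod_cast hi
    have hi1 : (0 : ℝ) < i := by exact_mod_cast Nat.pos_of_ne_zero hi0
    rw [hp, if_neg hi0, norm_mul, Complex.norm_intCast, Complex.norm_natCast]
    gcongr
    refine (sigma_le_pow_mul_one_add_log (by omega)).trans ?_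
    have : 0 ≤ Real.log i := Real.log_natCast_nonneg i
    gcongr
    linarith [Real.log_le_log hi1 hi']
  have h1 : 1 ≤ (n : ℝ) ^ (2 * r - 1) * L := one_le_mul_of_one_le_of_one_le (one_le_pow₀ hn1) hL1
  refine ⟨?_, fun _ i hi => ?_⟩
  · rw [Finset.sum_range_succ']
    have hsum : ∑ i ∈ Finset.range n, ‖p.coeff (i + 1)‖ ≤
        n * (|(c : ℝ)| * ((n : ℝ) ^ (2 * r - 1) * L)) := by
      refine (Finset.sum_le_card_nsmul _ _ _ fun i hi =>
        hpos (i + 1) (Finset.mem_range.1 hi) i.succ_ne_zero).trans_eq ?_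
      simp
    have h0 : ‖p.coeff 0‖ = 1 := by simp [hp]
    have hpow : (n : ℝ) ^ (2 * r) = n * (n : ℝ) ^ (2 * r - 1) := by
      rw [← pow_succ']
      congr 1
      omega
    calc _ ≤ n * (|(c : ℝ)| * ((n : ℝ) ^ (2 * r - 1) * L)) +
          n * ((n : ℝ) ^ (2 * r - 1) * L) := by
          rw [h0]
          exact add_le_add hsum (one_le_mul_of_one_le_of_one_le hn1 h1)
      _ = (|(c : ℝ)| + 1) * (n : ℝ) ^ (2 * r) * L := by
          rw [hpow]
          ring
      _ ≤ _ := by gcongr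
  · rcases eq_or_ne i 0 with rfl | hi0
    · have h25 : (1 : ℝ) ≤ 25 ^ r := one_le_pow₀ (by norm_num)
      rw [hp, if_pos rfl, norm_one]
      exact one_le_mul_of_one_le_of_one_le
        (one_le_mul_of_one_le_of_one_le h25 (one_le_pow₀ hn1)) (one_le_pow₀ hL1)
    · refine (hpos i hi hi0).trans ?_
      rw [← mul_assoc]
      gcongr
      linarith

lemma qExpansion_E2_coeff (n : ℕ) :
    (qExpansion 1 E2).coeff n = if n = 0 then 1 else ((-24 : ℤ) : ℂ) * σ (2 * 1 - 1) n := by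
  have hsum : ∀ τ : ℍ, HasSum
      (fun m : ℕ => (if m = 0 then 1 else -24 * σ 1 m : ℂ) • Function.Periodic.qParam 1 τ ^ m)
      (E2 τ) := fun τ => by
    simpa only [Function.Periodic.qParam, Complex.ofReal_one, div_one] using
      hasSum_qExpansion_E2 (z := τ)
  -- The uniqueness lemma is stated for bundled functions.
  let _ : FunLike (ℍ → ℂ) ℍ ℂ := ⟨id, Function.injective_id⟩
  refine (qExpansion_coeff_unique (F := ℍ → ℂ) E2 one_pos analyticAt_cuspFunction_E2
    hsum n).symm.trans ?_
  norm_num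

lemma qExpansion_E₄_coeff (n : ℕ) :
    (qExpansion 1 E₄).coeff n = if n = 0 then 1 else ((240 : ℤ) : ℂ) * σ (2 * 2 - 1) n := by
  rw [E_qExpansion_coeff _ ⟨2, rfl⟩, show bernoulli 4 = -1 / 30 by decide +kernel]
  norm_num

lemma qExpansion_E₆_coeff (n : ℕ) :
    (qExpansion 1 E₆).coeff n = if n = 0 then 1 else ((-504 : ℤ) : ℂ) * σ (2 * 3 - 1) n := by
  rw [E_qExpansion_coeff _ ⟨3, rfl⟩, show bernoulli 6 = 1 / 42 by decide +kernel]
  norm_num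

lemma qExpansion_eisensteinMonomial (k : ℕ) (p) :
    qExpansion 1 (eisensteinMonomial k p) =
      qExpansion 1 E2 ^ (k - (2 * (p.1.1 : ℕ) + 3 * (p.1.2 : ℕ))) *
        (qExpansion 1 E₄ ^ (p.1.1 : ℕ) * qExpansion 1 E₆ ^ (p.1.2 : ℕ)) := by
  let f₂ : cuspHolomorphic := ⟨E2, E2_mem_cuspHolomorphic⟩
  let f₄ : cuspHolomorphic := ⟨E₄, modularForm_mem_cuspHolomorphic E₄⟩
  let f₆ : cuspHolomorphic := ⟨E₆, modularForm_mem_cuspHolomorphic E₆⟩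
  have h : ∀ a b c : ℕ, cuspExpansion (f₂ ^ a * (f₄ ^ b * f₆ ^ c)) =
      cuspExpansion f₂ ^ a * (cuspExpansion f₄ ^ b * cuspExpansion f₆ ^ c) := fun a b c => by
    simp only [map_mul, map_pow]
  exact h _ _ _

lemma hasWeightGrowth_eisensteinMonomial (k : ℕ) (p) :
    HasWeightGrowth (qExpansion 1 (eisensteinMonomial k p)) k := by
  have h2 := hasWeightGrowth_of_sigma le_rfl qExpansion_E2_coeff (by norm_num)
  have h4 := hasWeightGrowth_of_sigma (by norm_num) qExpansion_E₄_coeff (by norm_num)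
  have h6 := hasWeightGrowth_of_sigma (by norm_num) qExpansion_E₆_coeff (by norm_num)
  rw [qExpansion_eisensteinMonomial]
  convert (h2.pow _).mul ((h4.pow _).mul (h6.pow _)) using 1
  have := p.2
  omega

lemma exists_int_qCoeff_eisensteinMonomial (k : ℕ) (p) (n : ℕ) :
    ∃ m : ℤ, qCoeff (eisensteinMonomial k p) n = m := by
  have hR : ∀ (q : PowerSeries ℂ) (c : ℤ) (s : ℕ),
      (∀ n, q.coeff n = if n = 0 then 1 else (c : ℂ) * σ s n) →
      q ∈ (PowerSeries.map (Int.castRingHom ℂ)).range := fun q c s hq =>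
    ⟨PowerSeries.mk fun n => if n = 0 then 1 else c * (σ s n : ℕ), by
      ext n
      rw [PowerSeries.coeff_map, PowerSeries.coeff_mk, hq]
      split_ifs <;> simp⟩
  have hmem : qExpansion 1 (eisensteinMonomial k p) ∈
      (PowerSeries.map (Int.castRingHom ℂ)).range := by
    rw [qExpansion_eisensteinMonomial]
    exact mul_mem (pow_mem (hR _ _ _ qExpansion_E2_coeff) _)
      (mul_mem (pow_mem (hR _ _ _ qExpansion_E₄_coeff) _)
        (pow_mem (hR _ _ _ qExpansion_E₆_coeff) _))
  obtain ⟨q, hq⟩ := hmem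
  refine ⟨q.coeff n, ?_⟩
  rw [qCoeff, ← hq, PowerSeries.coeff_map]
  rfl

lemma eisensteinMonomial_mem_integralQuasimodularForms (k : ℕ) (p) :
    eisensteinMonomial k p ∈ integralQuasimodularForms k :=
  ⟨span_eisensteinMonomial k ▸ Submodule.subset_span ⟨p, rfl⟩,
    exists_int_qCoeff_eisensteinMonomial k p⟩

/-! ### The integral basis -/

/-- The base `(k + 6) / 6` is at least `8 / 3` and the exponent `k² / 3` at least `3k`, so the
constant exceeds `((8 / 3)³ · 4)^k`, and `(8 / 3)³ · 4 > 75`. -/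
lemma succ_sq_mul_pow_le {k : ℕ} (hk : 10 ≤ k) :
    ((k : ℝ) + 1) ^ 2 * 25 ^ k ≤
      (((k : ℝ) + 6) / 6) ^ ((k : ℝ) ^ 2 / 3) * 109 * 2 ^ (2 * k - 1) := by
  have hk' : (10 : ℝ) ≤ k := by exact_mod_cast hk
  have hbase : (512 / 27 : ℝ) ^ k ≤ (((k : ℝ) + 6) / 6) ^ ((k : ℝ) ^ 2 / 3) :=
    calc (512 / 27 : ℝ) ^ k = (8 / 3 : ℝ) ^ ((3 * k : ℕ) : ℝ) := by
          rw [Real.rpow_natCast, pow_mul]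
          norm_num
      _ ≤ (((k : ℝ) + 6) / 6) ^ ((3 * k : ℕ) : ℝ) :=
          Real.rpow_le_rpow (by norm_num) (by linarith) (by positivity)
      _ ≤ _ := Real.rpow_le_rpow_of_exponent_le (by linarith) (by push_cast; nlinarith)
  have hsq : ((k : ℝ) + 1) ^ 2 ≤ 54 * 3 ^ k := by
    clear hbase
    induction k, hk using Nat.le_induction with
    | base => norm_num
    | succ n hn ih =>
      have hn' : (10 : ℝ) ≤ n := by exact_mod_cast hn
      have := ih hn'
      push_cast
      rw [pow_succ 3]
      nlinarith
  have h2 : (2 : ℝ) ^ (2 * k - 1) * 2 = 4 ^ k := by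
    rw [← pow_succ, show 2 * k - 1 + 1 = 2 * k by omega, pow_mul]
    norm_num
  calc ((k : ℝ) + 1) ^ 2 * 25 ^ k ≤ 54 * 3 ^ k * 25 ^ k := by gcongr
    _ = 54 * 75 ^ k := by
        rw [mul_assoc, ← mul_pow]
        norm_num
    _ ≤ 54 * (512 / 27 * 4) ^ k := by
        gcongr
        norm_num
    _ = (512 / 27) ^ k * 108 * 2 ^ (2 * k - 1) := by
        rw [mul_pow, ← h2]
        ring
    _ ≤ _ := by
        gcongr
        norm_num

lemma qCoeff_sum_smul {d : ℕ} {v : Fin d → ℍ → ℂ} (hv : ∀ j, v j ∈ cuspHolomorphic)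
    (x : Fin d → ℂ) (n : ℕ) : qCoeff (∑ j, x j • v j) n = ∑ j, x j * qCoeff (v j) n := by
  have h : ((∑ j, x j • (⟨v j, hv j⟩ : cuspHolomorphic) : cuspHolomorphic) : ℍ → ℂ) =
      ∑ j, x j • v j := by
    simp
  rw [qCoeff, ← h, ← cuspExpansion_apply, map_sum, map_sum]
  refine Finset.sum_congr rfl fun j _ => ?_
  rw [map_smul, PowerSeries.coeff_smul, smul_eq_mul]
  rfl

/-- The integral quasimodular forms have bounded denominators with respect to linearly independent
integral quasimodular forms spanning the space. -/
lemma exists_denominator_integralQuasimodularForms {k d : ℕ} {v : Fin d → ℍ → ℂ}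
    (hv : LinearIndependent ℂ v) (hspan : Submodule.span ℂ (Set.range v) = quasimodularForms k)
    (hvL : ∀ i, v i ∈ integralQuasimodularForms k) :
    ∃ D : ℤ, 0 < D ∧
      ∀ f ∈ integralQuasimodularForms k, ∃ x : Fin d → ℤ, D • f = ∑ j, x j • v j := by
  let V : Fin d → cuspHolomorphic := fun j => ⟨v j, quasimodularForms_le_cuspHolomorphic (hvL j).1⟩
  have hV : LinearIndependent ℂ V := LinearIndependent.of_comp cuspHolomorphic.val.toLinearMap hv
  choose u hu using fun j => (hvL j).2
  have hcoeff : ∀ x : Fin d → ℂ, ∀ n, qCoeff (∑ j, x j • v j) n = ∑ j, x j * u j n := by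
    intro x n
    rw [qCoeff_sum_smul fun j => quasimodularForms_le_cuspHolomorphic (hvL j).1]
    simp only [hu]
  have hu' : LinearIndependent ℂ fun j n => (u j n : ℂ) := by
    rw [Fintype.linearIndependent_iff]
    intro x hx
    refine Fintype.linearIndependent_iff.1 hV x (cuspExpansion_injective ?_)
    ext n
    have := hcoeff x n
    have hxn : ∑ j, x j * (u j n : ℂ) = 0 := by simpa using congr_fun hx n
    rw [hxn, qCoeff] at this
    rw [map_zero, map_zero, ← this, cuspExpansion_apply]
    simp [V]
  obtain ⟨D, hD, h⟩ := exists_common_denominator hu'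
  refine ⟨D, hD, fun f hf => ?_⟩
  obtain ⟨x, rfl⟩ : ∃ x : Fin d → ℂ, ∑ j, x j • v j = f :=
    (Submodule.mem_span_range_iff_exists_fun ℂ).1 (hspan ▸ hf.1)
  choose m hm using h x fun n => by
    obtain ⟨a, ha⟩ := hf.2 n
    exact ⟨a, by rw [← hcoeff, ha]⟩
  refine ⟨m, ?_⟩
  rw [← Int.cast_smul_eq_zsmul ℂ, Finset.smul_sum]
  refine Finset.sum_congr rfl fun j _ => ?_
  rw [smul_smul, hm, Int.cast_smul_eq_zsmul]

theorem proposition3p3 (k : ℕ) (hk : 10 ≤ k) :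
    ∃ b : Module.Basis (Fin (Module.finrank ℂ (quasimodularForms k))) ℤ
        (integralQuasimodularForms k),
      LinearIndependent ℂ (fun i => (b i : ℍ → ℂ)) ∧
      Submodule.span ℂ (Set.range fun i => (b i : ℍ → ℂ)) = quasimodularForms k ∧
      ∀ i, ∀ n : ℕ, 1 ≤ n →
        ‖qCoeff (b i : ℍ → ℂ) n‖ ≤
          (((k : ℝ) + 6) / 6) ^ ((k : ℝ) ^ 2 / 3) * 109 * 2 ^ (2 * k - 1) *
            (n : ℝ) ^ (2 * k - 1) * (1 + Real.log n) ^ k := by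
  obtain ⟨κ, a, ha, hspan, hli⟩ := exists_linearIndependent' ℂ (eisensteinMonomial k)
  rw [span_eisensteinMonomial] at hspan
  have : Finite κ := Finite.of_injective a ha
  have : Fintype κ := Fintype.ofFinite κ
  have hcard : Fintype.card κ = Module.finrank ℂ (quasimodularForms k) := by
    rw [← hspan, finrank_span_eq_card hli]
  -- A monomial of given weight is determined by its exponents of `E₄` and `E₆`.
  have hdim : Module.finrank ℂ (quasimodularForms k) ≤ (k + 1) ^ 2 := by
    rw [← hcard]
    refine (Fintype.card_le_of_injective a ha).trans ((Fintype.card_subtype_le _).trans_eq ?_)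
    simp [sq]
  generalize Module.finrank ℂ (quasimodularForms k) = d at hcard hdim
  subst hcard
  let e := (Fintype.equivFin κ).symm
  let v : Fin (Fintype.card κ) → ℍ → ℂ := fun j => eisensteinMonomial k (a (e j))
  have hv : LinearIndependent ℂ v := hli.comp e e.injective
  have hvspan : Submodule.span ℂ (Set.range v) = quasimodularForms k := by
    rw [← hspan]
    congr 1
    exact e.surjective.range_comp (eisensteinMonomial k ∘ a)
  have hvL : ∀ j, v j ∈ integralQuasimodularForms k := fun j =>
    eisensteinMonomial_mem_integralQuasimodularForms k _
  obtain ⟨D, hD, hden⟩ := exists_denominator_integralQuasimodularForms hv hvspan hvL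
  obtain ⟨b, hb⟩ := exists_basis_coord_le_one hv _ hvL hD hden
  have hbspan : Submodule.span ℂ (Set.range fun i => (b i : ℍ → ℂ)) = quasimodularForms k := by
    refine le_antisymm (Submodule.span_le.2 ?_) ?_
    · rintro _ ⟨i, rfl⟩
      exact (b i).2.1
    · rw [← hvspan, Submodule.span_le]
      rintro _ ⟨j, rfl⟩
      have := congr_arg Subtype.val (b.sum_repr (⟨v j, hvL j⟩ : integralQuasimodularForms k))
      simp only [Submodule.coe_sum, Submodule.coe_smul] at this
      rw [← this]
      exact sum_mem fun i _ => zsmul_mem (Submodule.subset_span (Set.mem_range_self i)) _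
  refine ⟨b, ?_, hbspan, fun i n hn => ?_⟩
  · rw [linearIndependent_iff_card_eq_finrank_span, Set.finrank, hbspan, ← hvspan,
      finrank_span_eq_card hv]
  · obtain ⟨t, ht, hbt⟩ := hb i
    have hcoeff : qCoeff (b i : ℍ → ℂ) n = ∑ j, t j * qCoeff (v j) n := by
      rw [hbt, qCoeff_sum_smul fun j => quasimodularForms_le_cuspHolomorphic (hvL j).1]
    have hlog : 0 ≤ Real.log n := Real.log_natCast_nonneg n
    rw [hcoeff]
    calc _ ≤ ∑ j : Fin (Fintype.card κ), 25 ^ k * (n : ℝ) ^ (2 * k - 1) * (1 + Real.log n) ^ k := by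
          refine (norm_sum_le _ _).trans (Finset.sum_le_sum fun j _ => ?_)
          rw [norm_mul]
          exact (mul_le_of_le_one_left (norm_nonneg _) (ht j)).trans
            ((hasWeightGrowth_eisensteinMonomial k _ n hn).2 (by omega) n le_rfl)
      _ = Fintype.card κ * 25 ^ k * (n : ℝ) ^ (2 * k - 1) * (1 + Real.log n) ^ k := by
          simp
          ring
      _ ≤ ((k : ℝ) + 1) ^ 2 * 25 ^ k * (n : ℝ) ^ (2 * k - 1) * (1 + Real.log n) ^ k := by
          gcongr
          exact_mod_cast hdim
      _ ≤ _ := by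
          have := succ_sq_mul_pow_le hk
          gcongr ?_ * _ * _
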